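/- Fix a universal prefix computer $U$, i.e. a partial recursive function $U(p,y)$ of a program $p\in\{0,1\}^*$ and an input $y$ which for each fixed input $y$ has a prefix-free domain, and which simulates every other such machine with programs that are longer by at most a constant. All complexities are lengths of shortest programs for $U$ ($\infty$ if there is none): $K(x)$ for a string $x$ and $K(S)$ for a finite set $S$ of strings use programs that, on empty input, output $x$, respectively an explicit list of the elements of $S$; $K(r)$ for a real $r\ge 0$ uses programs that, given $n$, output a dyadic rational within $2^{-n}$ of $r$. An *ensemble* is a computable probability distribution $\mathbb E$ on $\{0,1\}^*$ whose entropy $H(\mathbb E)=-\sum_s \mathbb E(s)\log_2\mathbb E(s)$ is finite and computable; $K(\mathbb E)$ uses programs that output approximations within $2^{-n}$ of $\mathbb E(s)$, given $s$ and $n$, and of $H(\mathbb E)$, given $n$. A set $\mathcal C$ of ensembles is *convex* if it contains every convex combination of finitely many of its elements with computable weights $\lambda_i\in(0,1)$, $\sum_i\lambda_i=1$; it is *decidable* if some algorithm decides, given a string $s$, whether the Dirac measure $\delta_s$ lies in $\mathcal C$, and $K(\mathcal C)$ is the length of a shortest program for $U$ that does so. For $\delta,\Delta\ge 0$, a string $x$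 and a set $\mathcal D$ of ensembles, the effective complexity is $$\mathcal E_{\delta,\Delta}(x\mid\mathcal D)=\inf\{K(\mathbb E)\ :\ \mathbb E\in\mathcal D,\ \mathbb E(x)\ge 2^{-H(\mathbb E)(1+\delta)},\ K(\mathbb E)+H(\mathbb E)\le K(x)+\Delta\},$$ which is $\infty$ if this set is empty; a *minimizing ensemble* is an $\mathbb E$ that satisfies the three conditions and attains the infimum. **Lemma (Ensembles and Sets).** There is a constant $c\in\mathbb N$, depending only on $U$, such that the following holds. Let $x\in\{0,1\}^*$ and $\delta,\Delta\ge 0$ be arbitrary, let $\mathcal C$ be a convex and decidable set of ensembles with $\delta_x\in\mathcal C$, let $\mathcal D$ be an arbitrary set of ensembles such that $\mathcal E_{\delta,\Delta}(x\mid\mathcal D)<\infty$, and let $\mathbb E$ be a corresponding minimizing ensemble. Then for every $\varepsilon>0$ there is a finite set $S\subset\{0,1\}^*$ containing $x$ such that $$\log_2\# S\le H(\mathbb E)(1+\delta)+\varepsilon,\qquad K(S)\le K(\mathbb E)+c+K(\delta)+K(\varepsilon)+K(\mathcal C),$$ and the uniform distribution on $S$ is an element of $\mathcal C$. -/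

import Mathlib

open scoped ENNReal

/-! ### Prefix computers

Programs are binary strings.  Inputs and outputs are natural numbers, which stand for finite objects
(strings, integers, pairs, lists, ...) through the computable coding `Encodable.encode` on which
Mathlib's notion of computability is based.  The number `0` stands for the empty input. -/

/-- A (conditional) prefix computer: a partial recursive function of a program and an input such that,
for every fixed input, no program on which it halts is a proper prefix of another one. -/
def IsPrefixComputer (M : List Bool → ℕ →. ℕ) : Prop :=
  Partrec₂ M ∧
    ∀ (y : ℕ) (p t : List Bool), (M p y).Dom → (M (p ++ t) y).Dom → t = []

/-- A universal prefix computer: a prefix computer that simulates every prefix computer, with programs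
that are longer by at most a constant. (This includes all the machines `U` for which there is a string `σ`
depending on `M` with `U (σ ++ p) y = M p y`.) -/
def IsUniversalPrefixComputer (U : List Bool → ℕ →. ℕ) : Prop :=
  IsPrefixComputer U ∧
    ∀ M : List Bool → ℕ →. ℕ, IsPrefixComputer M →
      ∃ c : ℕ, ∀ p : List Bool, ∃ q : List Bool,
        q.length ≤ p.length + c ∧ ∀ y : ℕ, U q y = M p y

/-- The length of a shortest program with property `P`, and `∞` if there is none. -/
noncomputable def shortestLength (P : List Bool → Prop) : ℕ∞ :=
  ⨅ (p : List Bool) (_ : P p), (p.length : ℕ∞)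

/-! ### Computable reals -/

/-- The natural number `m`, read as the finite binary expansion `a / 2 ^ b` with `m = ⟨a, b⟩`, is an
approximation of the (nonnegative) real `r` with accuracy `2 ^ (-n)`. -/
def IsApprox (m n : ℕ) (r : ℝ) : Prop :=
  |(m.unpair.1 : ℝ) / 2 ^ m.unpair.2 - r| ≤ 1 / 2 ^ n

/-- Computability of a nonnegative real number. -/
def IsComputableReal (r : ℝ) : Prop :=
  ∃ f : ℕ → ℕ, Computable f ∧ ∀ n, IsApprox (f n) n r

/-! ### Ensembles -/

/-- The Shannon entropy to base `2`, as an extended nonnegative real. -/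
noncomputable def entropy (E : PMF (List Bool)) : ℝ≥0∞ :=
  ∑' s : List Bool, ENNReal.ofReal (-((E s).toReal * Real.logb 2 (E s).toReal))

/-- The ensembles: the probability distributions on binary strings that are computable and whose entropy is
finite and computable. -/
def ensembles : Set (PMF (List Bool)) :=
  {E | (∃ f : List Bool × ℕ → ℕ, Computable f ∧ ∀ s n, IsApprox (f (s, n)) n (E s).toReal) ∧
    entropy E ≠ ∞ ∧ IsComputableReal (entropy E).toReal}

/-- `x` is `δ`-typical for `E`. -/
def IsTypical (δ : ℝ) (x : List Bool) (E : PMF (List Bool)) : Prop :=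
  (2 : ℝ) ^ (-((entropy E).toReal * (1 + δ))) ≤ (E x).toReal

/-! ### Prefix complexities with respect to a machine `U` -/

section Complexity

/-- `K(x)` for a string `x`. -/
noncomputable def KString (U : List Bool → ℕ →. ℕ) (x : List Bool) : ℕ∞ :=
  shortestLength fun p => Encodable.encode x ∈ U p 0

/-- `K(S)` for a finite set `S` of strings: the programs output an explicit list of the elements of `S`. -/
noncomputable def KFinset (U : List Bool → ℕ →. ℕ) (S : Finset (List Bool)) : ℕ∞ :=
  shortestLength fun p => ∃ l : List (List Bool), l.toFinset = S ∧ Encodable.encode l ∈ U p 0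

/-- `K(r)` for a nonnegative real `r`: given `n`, the programs output an approximation of `r` with
accuracy `2 ^ (-n)`. -/
noncomputable def KReal (U : List Bool → ℕ →. ℕ) (r : ℝ) : ℕ∞ :=
  shortestLength fun p => ∀ n : ℕ, ∃ m ∈ U p n, IsApprox m n r

/-- `K(E) = K(E, H(E))` for an ensemble `E`: given a string `s` and `n`, the programs output an approximation
of `E(s)` with accuracy `2 ^ (-n)`, and, given the request `none` and `n`, one of the entropy of `E`. -/
noncomputable def KEnsemble (U : List Bool → ℕ →. ℕ) (E : PMF (List Bool)) : ℕ∞ :=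
  shortestLength fun p =>
    (∀ (s : List Bool) (n : ℕ), ∃ m ∈ U p (Encodable.encode (some s, n)),
      IsApprox m n (E s).toReal) ∧
    (∀ n : ℕ, ∃ m ∈ U p (Encodable.encode ((none : Option (List Bool)), n)),
      IsApprox m n (entropy E).toReal)

open Classical in
/-- `K(C)` for a set `C` of ensembles: the programs decide, given a string `s`, whether the Dirac measure
on `s` belongs to `C`. -/
noncomputable def KConstraint (U : List Bool → ℕ →. ℕ) (C : Set (PMF (List Bool))) : ℕ∞ :=
  shortestLength fun p =>
    ∀ s : List Bool, Encodable.encode (decide (PMF.pure s ∈ C)) ∈ U p (Encodable.encode s)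

/-- The total information `Σ(E) = K(E) + H(E)`. -/
noncomputable def totalInformation (U : List Bool → ℕ →. ℕ) (E : PMF (List Bool)) : ℝ≥0∞ :=
  (KEnsemble U E : ℝ≥0∞) + entropy E

/-! ### Effective complexity -/

/-- The minimization domain of `x` for effective complexity. -/
def minimizationDomain (U : List Bool → ℕ →. ℕ) (δ Δ : ℝ) (x : List Bool) :
    Set (PMF (List Bool)) :=
  {E | E ∈ ensembles ∧ IsTypical δ x E ∧
    totalInformation U E ≤ (KString U x : ℝ≥0∞) + ENNReal.ofReal Δ}

/-- The effective complexity of `x` constrained to the set `D` of ensembles (`∞` if the constrained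
minimization domain is empty). -/
noncomputable def effectiveComplexity (U : List Bool → ℕ →. ℕ) (δ Δ : ℝ) (x : List Bool)
    (D : Set (PMF (List Bool))) : ℕ∞ :=
  ⨅ E ∈ minimizationDomain U δ Δ x ∩ D, KEnsemble U E

/-- `E` is a minimizing ensemble in the definition of the constrained effective complexity. -/
def IsMinimizingEnsemble (U : List Bool → ℕ →. ℕ) (δ Δ : ℝ) (x : List Bool)
    (D : Set (PMF (List Bool))) (E : PMF (List Bool)) : Prop :=
  E ∈ minimizationDomain U δ Δ x ∩ D ∧ KEnsemble U E = effectiveComplexity U δ Δ x D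

end Complexity

/-! ### Constraints -/

/-- A set of ensembles is convex if it contains every convex combination `Q`, with computable weights in
`(0, 1)`, of finitely many of its elements. -/
def IsConvexConstraint (C : Set (PMF (List Bool))) : Prop :=
  ∀ (k : ℕ) (E : Fin k → PMF (List Bool)) (w : Fin k → ℝ) (Q : PMF (List Bool)),
    (∀ i, E i ∈ C) → (∀ i, 0 < w i ∧ w i < 1) → (∀ i, IsComputableReal (w i)) → ∑ i, w i = 1 →
    (∀ s, (Q s).toReal = ∑ i, w i * (E i s).toReal) → Q ∈ C

/-- A set of ensembles is decidable if an algorithm decides, given a string `s`, whether the Dirac measure on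
`s` belongs to it. -/
def IsDecidableConstraint (C : Set (PMF (List Bool))) : Prop :=
  ComputablePred fun s : List Bool => PMF.pure s ∈ C

/-! In essence, `S` is a level set of `E` cut down by `C`: the strings `s` with `PMF.pure s ∈ C`
whose probability reaches a threshold `θ` strictly between `2 ^ (-(H (1 + δ) + ε))` and `2 ^ (-(H (1
+ δ)))`. Typicality puts `x` into `S`, total mass 1 gives `#S ≤ 1 / θ`, and the uniform distribution
on `S` is a convex combination of Dirac measures in `C` (`IsConvexConstraint.uniformOfFinset_mem`).

It remains to compute such a set from the concatenated shortest programs for `E`, `δ`, `ε` and `C`.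
Since comparing computable reals is undecidable, the machine searches for a certificate that integer
arithmetic can check: an accuracy `n`, a threshold `c / 2 ^ n` and a finite list `L` whose
complement has too little mass to contain a string of probability at least `(c + 3) / 2 ^ n`. The
room left by `ε` makes a certificate exist (`exists_thresholds`). The gap between `c` and `c + 3`
absorbs the approximation errors: `x` has probability at least `(c + 3) / 2 ^ n`, hence lies in `L`,
and its approximation is still at least `c` (`AreProgramsFor.certificateOutput_spec`). The
approximate level set may depend on the certificate found, but every certificate for these programs
serves.

Concatenations of self-delimiting programs split uniquely (`IsCertificate.append_unique`), so the
search is a prefix computer (`exists_levelSetComputer`), and `U` simulates it at constant cost. -/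

open Filter Topology

/-! ### Integer approximations -/

/-- A lower bound on `2 ^ n * r`, given an approximation `m` of `r` with accuracy `2 ^ (-n)`. -/
def dyadicFloor (n m : ℕ) : ℕ :=
  m.unpair.1 * 2 ^ n / 2 ^ m.unpair.2 - 1

/-- `a` is an approximation from below of `2 ^ n * r` with accuracy `3`. -/
def IsScaledApprox (a n : ℕ) (r : ℝ) : Prop :=
  (a : ℝ) ≤ 2 ^ n * r ∧ 2 ^ n * r ≤ a + 3

/-- The error 3 is made of one unit each for the accuracy of `m`, for the rounding in the division,
and for the 1 subtracted to get below `2 ^ n * r`. -/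
theorem IsApprox.isScaledApprox {m n : ℕ} {r : ℝ} (hr : 0 ≤ r) (h : IsApprox m n r) :
    IsScaledApprox (dyadicFloor n m) n r := by
  unfold IsApprox at h
  unfold dyadicFloor IsScaledApprox
  have h2 : (0 : ℝ) < 2 ^ n := by positivity
  have h3 : (0 : ℝ) < 2 ^ m.unpair.2 := by positivity
  set a := m.unpair.1
  set b := m.unpair.2
  set q := a * 2 ^ n / 2 ^ b with hq
  have hle : (q : ℝ) ≤ a * 2 ^ n / 2 ^ b := by
    have := @Nat.cast_div_le ℝ _ _ _ (a * 2 ^ n) (2 ^ b)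
    push_cast at this
    exact this
  have hlt : (a * 2 ^ n / 2 ^ b : ℝ) < q + 1 := by
    rw [div_lt_iff₀ h3]
    have : a * 2 ^ n < (q + 1) * 2 ^ b := by
      have := Nat.lt_mul_div_succ (a * 2 ^ n) (show 0 < 2 ^ b by positivity)
      rw [hq, mul_comm (_ + 1)]
      exact this
    exact_mod_cast this
  have heq : (a * 2 ^ n / 2 ^ b : ℝ) = 2 ^ n * (a / 2 ^ b) := by ring
  rw [heq] at hle hlt
  rw [abs_le] at h
  have e1 : (2 : ℝ) ^ n * (1 / 2 ^ n) = 1 := by field_simp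
  have l1 := mul_le_mul_of_nonneg_left h.1 h2.le
  have l2 := mul_le_mul_of_nonneg_left h.2 h2.le
  have hr2 : 0 ≤ 2 ^ n * r := by positivity
  -- The subtraction truncates at `q = 0`; the value 0 is then a lower bound because `r ≥ 0`.
  have c1 : ((q - 1 : ℕ) : ℝ) ≤ max ((q : ℝ) - 1) 0 := by
    rcases Nat.eq_zero_or_pos q with h0 | h0
    · simp [h0]
    · rw [Nat.cast_sub h0]; simp
  have c2 : (q : ℝ) - 1 ≤ ((q - 1 : ℕ) : ℝ) := by
    have : q ≤ (q - 1) + 1 := by omega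
    have : (q : ℝ) ≤ ((q - 1 : ℕ) : ℝ) + 1 := by exact_mod_cast this
    linarith
  constructor
  · refine c1.trans (max_le ?_ hr2)
    nlinarith
  · nlinarith

theorem IsScaledApprox.tendsto {a : ℕ → ℕ} {r : ℝ} (h : ∀ n, IsScaledApprox (a n) n r) :
    Tendsto (fun n => (a n : ℝ) / 2 ^ n) atTop (𝓝 r) := by
  have h0 : Tendsto (fun n : ℕ => r - 3 * (1 / 2 : ℝ) ^ n) atTop (𝓝 r) := by
    simpa using tendsto_const_nhds.sub
      ((tendsto_pow_atTop_nhds_zero_of_lt_one (by norm_num : (0 : ℝ) ≤ 1 / 2)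
        (by norm_num)).const_mul 3)
  refine tendsto_of_tendsto_of_tendsto_of_le_of_le h0 tendsto_const_nhds (fun n => ?_) (fun n => ?_)
  · have := (h n).2
    have h2 : (0 : ℝ) < 2 ^ n := by positivity
    simp only [one_div, inv_pow]
    rw [le_div_iff₀ h2, sub_mul, mul_assoc, inv_mul_cancel₀ h2.ne']
    linarith
  · have := (h n).1
    have h2 : (0 : ℝ) < 2 ^ n := by positivity
    simp only
    rw [div_le_iff₀ h2]
    linarith

theorem isScaledApprox_floor {r : ℝ} (hr : 0 ≤ r) (n : ℕ) : IsScaledApprox ⌊2 ^ n * r⌋₊ n r :=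
  ⟨Nat.floor_le (by positivity), by linarith [Nat.lt_floor_add_one (2 ^ n * r)]⟩

/-! ### Certified level sets -/

/-- `c / 2 ^ n` is at least `2 ^ (-(H (1 + δ) + ε))`, as witnessed by lower approximations of `H`, `δ`
and `ε`. -/
def ThresholdLower (h d e n c : ℕ) : Prop :=
  2 ^ (n * 4 ^ n) ≤ c ^ 4 ^ n * 2 ^ (h * (2 ^ n + d) + e * 2 ^ n)

/-- `(c + 3) / 2 ^ n` is at most `2 ^ (-(H (1 + δ)))`, as witnessed by lower approximations of `H` and
`δ`. -/
def ThresholdUpper (h d n c : ℕ) : Prop :=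
  (c + 3) ^ 4 ^ n * 2 ^ ((h + 3) * (2 ^ n + d + 3)) ≤ 2 ^ (n * 4 ^ n)

/-- The logarithmic form of the condition needs this: with `Real.logb 2 0 = 0` it would hold for `c
= 0`. -/
theorem ThresholdLower.pos {h d e n c : ℕ} (hc : ThresholdLower h d e n c) : 0 < c := by
  rcases Nat.eq_zero_or_pos c with rfl | h0
  · unfold ThresholdLower at hc
    rw [zero_pow (by positivity), zero_mul] at hc
    exact absurd hc (by simp)
  · exact h0

theorem four_pow_eq_mul (n : ℕ) : (4 : ℝ) ^ n = 2 ^ n * 2 ^ n := by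
  rw [← mul_pow]; norm_num

/-- Take logarithms and divide by `4 ^ n`, the common denominator of the product of two fractions
over `2 ^ n`. This turns a comparison of logarithms into one of natural numbers. -/
theorem thresholdLower_iff {h d e n c : ℕ} (hc : 0 < c) :
    ThresholdLower h d e n c ↔
      -Real.logb 2 (c / 2 ^ n) ≤ (h / 2 ^ n : ℝ) * (1 + d / 2 ^ n) + e / 2 ^ n := by
  have hc' : (0 : ℝ) < c := by exact_mod_cast hc
  have h2 : (0 : ℝ) < 2 ^ n := by positivity
  have h4 : (0 : ℝ) < 4 ^ n := by positivity
  unfold ThresholdLower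
  rw [← @Nat.cast_le ℝ]
  push_cast
  rw [← Real.logb_le_logb (b := 2) (by norm_num) (by positivity) (by positivity),
    Real.logb_mul (by positivity) (by positivity), Real.logb_div hc'.ne' h2.ne']
  simp only [Real.logb_pow, Real.logb_self_eq_one (by norm_num : (1 : ℝ) < 2), mul_one]
  push_cast
  refine Iff.trans ?_ (mul_le_mul_iff_right₀ h4)
  have : (4 : ℝ) ^ n * (h / 2 ^ n * (1 + d / 2 ^ n) + e / 2 ^ n) = h * (2 ^ n + d) + e * 2 ^ n := by
    rw [four_pow_eq_mul]; field_simp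
  rw [this]
  constructor <;> intro h <;> nlinarith

theorem thresholdUpper_iff {h d n c : ℕ} :
    ThresholdUpper h d n c ↔
      ((h + 3 : ℕ) / 2 ^ n : ℝ) * (1 + (d + 3 : ℕ) / 2 ^ n) ≤ -Real.logb 2 ((c + 3 : ℕ) / 2 ^ n) := by
  have hc' : (0 : ℝ) < (c + 3 : ℕ) := by positivity
  have h2 : (0 : ℝ) < 2 ^ n := by positivity
  have h4 : (0 : ℝ) < 4 ^ n := by positivity
  unfold ThresholdUpper
  rw [← @Nat.cast_le ℝ, Nat.cast_mul, Nat.cast_pow, Nat.cast_pow, Nat.cast_pow]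
  simp only [Nat.cast_ofNat]
  rw [← Real.logb_le_logb (b := 2) (by norm_num) (by positivity) (by positivity),
    Real.logb_mul (by positivity) (by positivity), Real.logb_div hc'.ne' h2.ne']
  simp only [Real.logb_pow, Real.logb_self_eq_one (by norm_num : (1 : ℝ) < 2), mul_one]
  refine Iff.trans ?_ (mul_le_mul_iff_right₀ h4)
  have : (4 : ℝ) ^ n * ((h + 3 : ℕ) / 2 ^ n * (1 + (d + 3 : ℕ) / 2 ^ n))
      = ((h + 3) * (2 ^ n + d + 3) : ℕ) := by
    rw [four_pow_eq_mul]; push_cast; field_simp; ring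
  rw [this]
  push_cast
  constructor <;> intro h <;> nlinarith

/-- Each element has mass at least `c / 2 ^ n`, so there are at most `2 ^ n / c` of them. The bound
increases with `H`, `δ` and `ε`, so lower approximations suffice. -/
theorem ThresholdLower.logb_card_le {α : Type*} {P : α → ℝ} (hP : ∀ S : Finset α, ∑ s ∈ S, P s ≤ 1)
    {h d e n c : ℕ} {H δ ε : ℝ} (hc : ThresholdLower h d e n c)
    (hh : IsScaledApprox h n H) (hd : IsScaledApprox d n δ) (he : (e : ℝ) ≤ 2 ^ n * ε)
    {S : Finset α} (hS : S.Nonempty) (hcS : ∀ s ∈ S, (c : ℝ) ≤ 2 ^ n * P s) :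
    Real.logb 2 S.card ≤ H * (1 + δ) + ε := by
  have h0 := hc.pos
  have h0' : (0 : ℝ) < c := by exact_mod_cast h0
  rw [thresholdLower_iff h0] at hc
  have h2 : (0 : ℝ) < 2 ^ n := by positivity
  have hcard : (0 : ℝ) < S.card := by exact_mod_cast hS.card_pos
  have k1 : (S.card : ℝ) ≤ 2 ^ n / c := by
    rw [le_div_iff₀ h0']
    calc (S.card : ℝ) * c = ∑ s ∈ S, (c : ℝ) := by simp
      _ ≤ ∑ s ∈ S, 2 ^ n * P s := Finset.sum_le_sum hcS
      _ = 2 ^ n * ∑ s ∈ S, P s := by rw [Finset.mul_sum]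
      _ ≤ 2 ^ n * 1 := by gcongr; exact hP S
      _ = 2 ^ n := mul_one _
  have k2 : Real.logb 2 S.card ≤ -Real.logb 2 (c / 2 ^ n) := by
    rw [← Real.logb_inv, inv_div]
    exact Real.logb_le_logb_of_le (by norm_num) hcard k1
  have q1 : (h / 2 ^ n : ℝ) ≤ H := by rw [div_le_iff₀ h2]; linarith [hh.1]
  have q2 : (d / 2 ^ n : ℝ) ≤ δ := by rw [div_le_iff₀ h2]; linarith [hd.1]
  have q3 : (e / 2 ^ n : ℝ) ≤ ε := by rw [div_le_iff₀ h2]; linarith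
  have q0 : (0 : ℝ) ≤ h / 2 ^ n := by positivity
  have q4 : (0 : ℝ) ≤ d / 2 ^ n := by positivity
  refine (k2.trans hc).trans ?_
  gcongr
  exact q0.trans q1

theorem ThresholdUpper.le {h d n c : ℕ} {H δ p : ℝ} (hc : ThresholdUpper h d n c)
    (hh : IsScaledApprox h n H) (hd : IsScaledApprox d n δ) (hδ : 0 ≤ δ)
    (hp : (2 : ℝ) ^ (-(H * (1 + δ))) ≤ p) :
    ((c : ℝ) + 3) ≤ 2 ^ n * p := by
  have h2 : (0 : ℝ) < 2 ^ n := by positivity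
  have h0 : (0 : ℝ) < (c + 3 : ℕ) / 2 ^ n := by positivity
  rw [thresholdUpper_iff] at hc
  have q1 : H ≤ ((h + 3 : ℕ) / 2 ^ n : ℝ) := by
    rw [le_div_iff₀ h2]; push_cast; linarith [hh.2]
  have q2 : δ ≤ ((d + 3 : ℕ) / 2 ^ n : ℝ) := by
    rw [le_div_iff₀ h2]; push_cast; linarith [hd.2]
  have q3 : H * (1 + δ) ≤ -Real.logb 2 ((c + 3 : ℕ) / 2 ^ n) := by
    refine le_trans ?_ hc
    gcongr
  have q4 : ((c + 3 : ℕ) / 2 ^ n : ℝ) ≤ 2 ^ (-(H * (1 + δ))) := by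
    rw [← Real.logb_le_iff_le_rpow (by norm_num) h0]
    linarith
  have q5 := q4.trans hp
  rw [div_le_iff₀ h2] at q5
  push_cast at q5
  linarith

/-- After division by `2 ^ n` the errors vanish as `n` grows. With a threshold strictly inside the
interval opened by `ε`, all conditions are strict in the limit, hence hold for large `n`. -/
theorem exists_thresholds {α : Type*} {P : α → ℝ} (hP : HasSum P 1) {h d e : ℕ → ℕ} {f : α → ℕ → ℕ}
    {H δ ε : ℝ} (hh : ∀ n, IsScaledApprox (h n) n H) (hd : ∀ n, IsScaledApprox (d n) n δ)
    (he : ∀ n, IsScaledApprox (e n) n ε) (hf : ∀ s n, IsScaledApprox (f s n) n (P s)) (hε : 0 < ε) :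
    ∃ (n c : ℕ) (L : Finset α), ThresholdLower (h n) (d n) (e n) n c ∧ ThresholdUpper (h n) (d n) n c ∧
      2 ^ n < ∑ s ∈ L, f s n + c + 3 := by
  obtain ⟨u, hu1, hu2⟩ := exists_between (show H * (1 + δ) < H * (1 + δ) + ε by linarith)
  set θ : ℝ := 2 ^ (-u) with hθ
  have hθ0 : 0 < θ := by positivity
  have hlog : Real.logb 2 θ = -u := by
    rw [hθ, Real.logb_rpow (by norm_num) (by norm_num)]
  -- `L` is fixed before `n`, so only finitely many approximations have to converge.
  obtain ⟨L, hL⟩ := (hP.eventually_const_lt (show 1 - θ < 1 by linarith)).exists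
  set c : ℕ → ℕ := fun n => ⌊2 ^ n * θ⌋₊
  have tc : Tendsto (fun n => (c n : ℝ) / 2 ^ n) atTop (𝓝 θ) :=
    IsScaledApprox.tendsto (isScaledApprox_floor hθ0.le)
  have t3 : Tendsto (fun n : ℕ => 3 * (1 / 2 : ℝ) ^ n) atTop (𝓝 0) := by
    simpa using (tendsto_pow_atTop_nhds_zero_of_lt_one (by norm_num : (0 : ℝ) ≤ 1 / 2)
        (by norm_num)).const_mul 3
  have add3 : ∀ {a : ℕ → ℕ} {r : ℝ}, Tendsto (fun n => (a n : ℝ) / 2 ^ n) atTop (𝓝 r) →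
      Tendsto (fun n => ((a n + 3 : ℕ) : ℝ) / 2 ^ n) atTop (𝓝 r) := by
    intro a r ha
    have := ha.add t3
    rw [add_zero] at this
    refine this.congr fun n => ?_
    push_cast
    rw [one_div, inv_pow, add_div, div_eq_mul_inv (3 : ℝ)]
  have th := IsScaledApprox.tendsto hh
  have td := IsScaledApprox.tendsto hd
  have te := IsScaledApprox.tendsto he
  have e0 : ∀ᶠ n in atTop, 0 < c n := by
    filter_upwards [tc.eventually_const_lt hθ0] with n hn
    by_contra h0
    simp only [not_lt, Nat.le_zero] at h0
    simp [h0] at hn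
  have e1 : ∀ᶠ n in atTop, ThresholdLower (h n) (d n) (e n) n (c n) := by
    have l1 := (tc.logb (b := 2) hθ0.ne').neg
    have l2 := (th.mul (td.const_add 1)).add te
    rw [hlog, neg_neg] at l1
    filter_upwards [l1.eventually_lt l2 hu2, e0] with n hn h0
    exact (thresholdLower_iff h0).2 hn.le
  have e2 : ∀ᶠ n in atTop, ThresholdUpper (h n) (d n) n (c n) := by
    have l1 := ((add3 tc).logb (b := 2) hθ0.ne').neg
    have l2 := (add3 th).mul ((add3 td).const_add 1)
    rw [hlog, neg_neg] at l1
    filter_upwards [l2.eventually_lt l1 hu1] with n hn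
    exact thresholdUpper_iff.2 hn.le
  have e3 : ∀ᶠ n in atTop, 2 ^ n < ∑ s ∈ L, f s n + c n + 3 := by
    have l1 : Tendsto (fun n => ∑ s ∈ L, (f s n : ℝ) / 2 ^ n) atTop (𝓝 (∑ s ∈ L, P s)) :=
      tendsto_finsetSum _ fun s _ => IsScaledApprox.tendsto (hf s)
    filter_upwards [(l1.add tc).eventually_const_lt (show 1 < ∑ s ∈ L, P s + θ by linarith)] with n hn
    rw [← Finset.sum_div, ← add_div, one_lt_div (by positivity)] at hn
    have : 2 ^ n < ∑ s ∈ L, f s n + c n := by exact_mod_cast hn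
    omega
  obtain ⟨n, h1, h2, h3⟩ := (e1.and (e2.and e3)).exists
  exact ⟨n, c n, L, h1, h2, h3⟩

/-! ### Searching for certificates -/

theorem exists_partrec_search {α W σ : Type*} [Primcodable α] [Primcodable W] [Primcodable σ]
    {g : α → W → Option σ} (hg : Primrec₂ g) :
    ∃ f : α →. σ, Partrec f ∧ (∀ a, ∀ b ∈ f a, ∃ w, g a w = some b) ∧
      ∀ a, (∃ w, (g a w).isSome) → (f a).Dom := by
  let g' : α → ℕ → Option σ := fun a k => (Encodable.decode (α := W) k).bind (g a)
  have hg' : Primrec₂ g' :=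
    Primrec.option_bind (Primrec.decode.comp Primrec.snd)
      (hg.comp (Primrec.fst.comp Primrec.fst) Primrec.snd)
  refine ⟨fun a => Nat.rfindOpt (g' a), Partrec.rfindOpt hg'.to_comp, ?_, ?_⟩
  · intro a b hb
    obtain ⟨k, hk⟩ := Nat.rfindOpt_spec hb
    obtain ⟨w, -, hw⟩ := Option.bind_eq_some_iff.1 hk
    exact ⟨w, hw⟩
  · rintro a ⟨w, hw⟩
    obtain ⟨b, hb⟩ := Option.isSome_iff_exists.1 hw
    exact Nat.rfindOpt_dom.2 ⟨Encodable.encode w, b, by simp [g', hb]⟩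

/-- Step-bounded evaluation of a partial recursive function. -/
theorem exists_stepBounded {U : List Bool → ℕ →. ℕ} (hU : Partrec₂ U) :
    ∃ R : ℕ → List Bool → ℕ → Option ℕ,
      (Primrec fun a : ℕ × List Bool × ℕ => R a.1 a.2.1 a.2.2) ∧
      (∀ T p y v, R T p y = some v → v ∈ U p y) ∧
      ∀ p y v, v ∈ U p y → ∀ᶠ T in atTop, R T p y = some v := by
  obtain ⟨c, hc⟩ := Nat.Partrec.Code.exists_code.1 hU
  have hmem : ∀ p y v, v ∈ c.eval (Encodable.encode (p, y)) ↔ v ∈ U p y := by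
    intro p y v
    rw [hc]
    simp
  refine ⟨fun T p y => Nat.Partrec.Code.evaln T c (Encodable.encode (p, y)), ?_, ?_, ?_⟩
  · exact Nat.Partrec.Code.primrec_evaln.comp
      ((Primrec.fst.pair (Primrec.const c)).pair (Primrec.encode.comp Primrec.snd))
  · intro T p y v h
    exact (hmem p y v).1 (Nat.Partrec.Code.evaln_sound h)
  · intro p y v h
    obtain ⟨k, hk⟩ := Nat.Partrec.Code.evaln_complete.1 ((hmem p y v).2 h)
    filter_upwards [eventually_ge_atTop k] with T hT
    exact Nat.Partrec.Code.evaln_mono hT hk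

theorem primrec_nat_pow : Primrec₂ ((· ^ ·) : ℕ → ℕ → ℕ) :=
  Primrec₂.unpaired'.1 Nat.Primrec.pow

theorem primrec_list_sum : Primrec (List.sum : List ℕ → ℕ) := by
  refine (Primrec.list_foldr Primrec.id (Primrec.const 0)
    (Primrec.nat_add.comp (Primrec.fst.comp Primrec.snd) (Primrec.snd.comp Primrec.snd)).to₂).of_eq ?_
  intro l
  rfl

theorem primrec_dyadicFloor : Primrec₂ dyadicFloor :=
  Primrec.nat_sub.comp
    (Primrec.nat_div.comp
      (Primrec.nat_mul.comp (Primrec.fst.comp (Primrec.unpair.comp Primrec.snd))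
        (primrec_nat_pow.comp (Primrec.const 2) Primrec.fst))
      (primrec_nat_pow.comp (Primrec.const 2) (Primrec.snd.comp (Primrec.unpair.comp Primrec.snd))))
    (Primrec.const 1)

/-- A list has no repetition exactly when every entry first occurs at its own position. -/
theorem primrecPred_nodup {α : Type*} [Primcodable α] [DecidableEq α] :
    PrimrecPred (List.Nodup : List α → Prop) := by
  have h : PrimrecPred fun l : List α => l.map (fun s => l.idxOf s) = List.range l.length :=
    Primrec.eq.comp (Primrec.list_map Primrec.id (Primrec.list_idxOf.comp Primrec.snd Primrec.fst))
      (Primrec.list_range.comp Primrec.list_length)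
  refine h.of_eq fun l => ⟨fun hl => ?_, fun hl => ?_⟩
  · exact List.Nodup.of_map _ (hl ▸ List.nodup_range)
  · refine List.ext_getElem (by simp) fun i h1 h2 => ?_
    simp [hl.idxOf_getElem]

/-! ### The certificates -/

/-- A certificate for a level set: a quadruple of programs (for an ensemble, `δ`, `ε` and a constraint),
a number of steps, an accuracy, a threshold, and a list of strings. -/
abbrev LevelSetCertificate : Type :=
  (List Bool × List Bool × List Bool × List Bool) × ℕ × ℕ × ℕ × List (List Bool)

section Certificate

variable (R : ℕ → List Bool → ℕ → Option ℕ)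

/-- A lower bound on `2 ^ n * r`, where the program `p` on input `y` computes an approximation of `r`
with accuracy `2 ^ (-n)`; it is `0` if this takes more than `T` steps. -/
def evalFloor (T n : ℕ) (p : List Bool) (y : ℕ) : ℕ :=
  ((R T p y).map (dyadicFloor n)).getD 0

/-- The input on which a program for an ensemble approximates the probability of `s`. -/
def probQuery (s : List Bool) (n : ℕ) : ℕ := Encodable.encode (some s, n)

/-- The input on which a program for an ensemble approximates the entropy. -/
def entropyQuery (n : ℕ) : ℕ := Encodable.encode ((none : Option (List Bool)), n)

/-- The programs of the certificate halt on the inputs that are used for the parsing. -/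
def CertificateParses (w : LevelSetCertificate) : Prop :=
  R w.2.1 w.1.1 (entropyQuery 0) ≠ none ∧ R w.2.1 w.1.2.1 0 ≠ none ∧ R w.2.1 w.1.2.2.1 0 ≠ none ∧
    R w.2.1 w.1.2.2.2 (Encodable.encode ([] : List Bool)) ≠ none

/-- The evaluations on which the certificate relies halt. -/
def CertificateHalts (w : LevelSetCertificate) : Prop :=
  R w.2.1 w.1.1 (entropyQuery w.2.2.1) ≠ none ∧ R w.2.1 w.1.2.1 w.2.2.1 ≠ none ∧
    ∀ s ∈ w.2.2.2.2, R w.2.1 w.1.1 (probQuery s w.2.2.1) ≠ none ∧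
      R w.2.1 w.1.2.2.2 (Encodable.encode s) ≠ none

/-- The integer lower bound on the probability of `s`. -/
def certificateProb (w : LevelSetCertificate) (s : List Bool) : ℕ :=
  evalFloor R w.2.1 w.2.2.1 w.1.1 (probQuery s w.2.2.1)

/-- The certified numerical bounds on the threshold and on the total probability of the list. -/
def CertificateBounds (w : LevelSetCertificate) : Prop :=
  ThresholdLower (evalFloor R w.2.1 w.2.2.1 w.1.1 (entropyQuery w.2.2.1))
      (evalFloor R w.2.1 w.2.2.1 w.1.2.1 w.2.2.1) (evalFloor R w.2.1 w.2.2.1 w.1.2.2.1 w.2.2.1)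
      w.2.2.1 w.2.2.2.1 ∧
    ThresholdUpper (evalFloor R w.2.1 w.2.2.1 w.1.1 (entropyQuery w.2.2.1))
      (evalFloor R w.2.1 w.2.2.1 w.1.2.1 w.2.2.1) w.2.2.1 w.2.2.2.1 ∧
    w.2.2.2.2.Nodup ∧ 2 ^ w.2.2.1 < (w.2.2.2.2.map (certificateProb R w)).sum + w.2.2.2.1 + 3

/-- The certificate `w` is valid for the program `p`. -/
def IsCertificate (p : List Bool) (w : LevelSetCertificate) : Prop :=
  p = w.1.1 ++ (w.1.2.1 ++ (w.1.2.2.1 ++ w.1.2.2.2)) ∧ CertificateParses R w ∧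
    CertificateHalts R w ∧ CertificateBounds R w

/-- The level set that is described by a certificate. -/
def certificateOutput (w : LevelSetCertificate) : List (List Bool) :=
  w.2.2.2.2.filter fun s => decide (w.2.2.2.1 ≤ certificateProb R w s ∧
    R w.2.1 w.1.2.2.2 (Encodable.encode s) = some (Encodable.encode true))

end Certificate

/-! ### Primitive recursiveness of checking certificates and reading off their level sets -/

theorem primrec_entropyQuery : Primrec entropyQuery :=
  Primrec.encode.comp ((Primrec.const none).pair Primrec.id)

theorem primrec_probQuery : Primrec₂ probQuery :=
  Primrec.encode.comp ((Primrec.option_some.comp Primrec.fst).pair Primrec.snd)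

section Primrec

variable {R : ℕ → List Bool → ℕ → Option ℕ} {α : Type*} [Primcodable α]

theorem primrec_eval (hR : Primrec fun a : ℕ × List Bool × ℕ => R a.1 a.2.1 a.2.2)
    {T : α → ℕ} {p : α → List Bool} {y : α → ℕ}
    (hT : Primrec T) (hp : Primrec p) (hy : Primrec y) : Primrec fun a => R (T a) (p a) (y a) :=
  hR.comp (hT.pair (hp.pair hy))

theorem primrec_evalFloor (hR : Primrec fun a : ℕ × List Bool × ℕ => R a.1 a.2.1 a.2.2)
    {T n : α → ℕ} {p : α → List Bool} {y : α → ℕ}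
    (hT : Primrec T) (hn : Primrec n) (hp : Primrec p) (hy : Primrec y) :
    Primrec fun a => evalFloor R (T a) (n a) (p a) (y a) :=
  Primrec.option_getD.comp
    (Primrec.option_map (primrec_eval hR hT hp hy)
      (primrec_dyadicFloor.comp (hn.comp Primrec.fst) Primrec.snd))
    (Primrec.const 0)

theorem primrecPred_eval_ne_none (hR : Primrec fun a : ℕ × List Bool × ℕ => R a.1 a.2.1 a.2.2)
    {T : α → ℕ} {p : α → List Bool} {y : α → ℕ}
    (hT : Primrec T) (hp : Primrec p) (hy : Primrec y) :
    PrimrecPred fun a => R (T a) (p a) (y a) ≠ none :=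
  (Primrec.eq.comp (primrec_eval hR hT hp hy) (Primrec.const none)).not

theorem primrecPred_thresholdLower {h d e n c : α → ℕ} (hh : Primrec h) (hd : Primrec d)
    (he : Primrec e) (hn : Primrec n) (hc : Primrec c) :
    PrimrecPred fun a => ThresholdLower (h a) (d a) (e a) (n a) (c a) := by
  have h2 : Primrec fun a => 2 ^ n a := primrec_nat_pow.comp (Primrec.const 2) hn
  have h4 : Primrec fun a => 4 ^ n a := primrec_nat_pow.comp (Primrec.const 4) hn
  exact Primrec.nat_le.comp
    (primrec_nat_pow.comp (Primrec.const 2) (Primrec.nat_mul.comp hn h4))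
    (Primrec.nat_mul.comp (primrec_nat_pow.comp hc h4)
      (primrec_nat_pow.comp (Primrec.const 2)
        (Primrec.nat_add.comp (Primrec.nat_mul.comp hh (Primrec.nat_add.comp h2 hd))
          (Primrec.nat_mul.comp he h2))))

theorem primrecPred_thresholdUpper {h d n c : α → ℕ} (hh : Primrec h) (hd : Primrec d)
    (hn : Primrec n) (hc : Primrec c) :
    PrimrecPred fun a => ThresholdUpper (h a) (d a) (n a) (c a) := by
  have h2 : Primrec fun a => 2 ^ n a := primrec_nat_pow.comp (Primrec.const 2) hn
  have h4 : Primrec fun a => 4 ^ n a := primrec_nat_pow.comp (Primrec.const 4) hn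
  have h3 : Primrec fun _ : α => 3 := Primrec.const 3
  exact Primrec.nat_le.comp
    (Primrec.nat_mul.comp (primrec_nat_pow.comp (Primrec.nat_add.comp hc h3) h4)
      (primrec_nat_pow.comp (Primrec.const 2)
        (Primrec.nat_mul.comp (Primrec.nat_add.comp hh h3)
          (Primrec.nat_add.comp (Primrec.nat_add.comp h2 hd) h3))))
    (primrec_nat_pow.comp (Primrec.const 2) (Primrec.nat_mul.comp hn h4))

end Primrec

section Primrec

variable {R : ℕ → List Bool → ℕ → Option ℕ}

theorem primrec_certificateProb (hR : Primrec fun a : ℕ × List Bool × ℕ => R a.1 a.2.1 a.2.2) :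
    Primrec₂ (certificateProb R) := by
  have w : Primrec (Prod.fst : LevelSetCertificate × List Bool → LevelSetCertificate) := Primrec.fst
  have w2 := Primrec.snd.comp w
  have n := Primrec.fst.comp (Primrec.snd.comp w2)
  exact primrec_evalFloor hR (Primrec.fst.comp w2) n (Primrec.fst.comp (Primrec.fst.comp w))
    (primrec_probQuery.comp Primrec.snd n)

theorem primrecPred_certificateParses
    (hR : Primrec fun a : ℕ × List Bool × ℕ => R a.1 a.2.1 a.2.2) :
    PrimrecPred (CertificateParses R) := by
  have w : Primrec (id : LevelSetCertificate → LevelSetCertificate) := Primrec.id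
  have T := Primrec.fst.comp (Primrec.snd.comp w)
  have p1 := Primrec.fst.comp (Primrec.fst.comp w)
  have q1 := Primrec.snd.comp (Primrec.fst.comp w)
  have q2 := Primrec.snd.comp q1
  exact (primrecPred_eval_ne_none hR T p1 (Primrec.const _)).and
    ((primrecPred_eval_ne_none hR T (Primrec.fst.comp q1) (Primrec.const _)).and
      ((primrecPred_eval_ne_none hR T (Primrec.fst.comp q2) (Primrec.const _)).and
        (primrecPred_eval_ne_none hR T (Primrec.snd.comp q2) (Primrec.const _))))

theorem primrecPred_certificateHalts
    (hR : Primrec fun a : ℕ × List Bool × ℕ => R a.1 a.2.1 a.2.2) :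
    PrimrecPred (CertificateHalts R) := by
  have w : Primrec (id : LevelSetCertificate → LevelSetCertificate) := Primrec.id
  have w2 := Primrec.snd.comp w
  have T := Primrec.fst.comp w2
  have n := Primrec.fst.comp (Primrec.snd.comp w2)
  have p1 := Primrec.fst.comp (Primrec.fst.comp w)
  have q1 := Primrec.snd.comp (Primrec.fst.comp w)
  have p4 := Primrec.snd.comp (Primrec.snd.comp q1)
  have L := Primrec.snd.comp (Primrec.snd.comp (Primrec.snd.comp w2))
  have hrel : PrimrecRel fun (s : List Bool) (w : LevelSetCertificate) =>
      R w.2.1 w.1.1 (probQuery s w.2.2.1) ≠ none ∧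
        R w.2.1 w.1.2.2.2 (Encodable.encode s) ≠ none := by
    have v : Primrec (Prod.snd : List Bool × LevelSetCertificate → _) := Primrec.snd
    exact (primrecPred_eval_ne_none hR (T.comp v) (p1.comp v)
      (primrec_probQuery.comp Primrec.fst (n.comp v))).and
      (primrecPred_eval_ne_none hR (T.comp v) (p4.comp v) (Primrec.encode.comp Primrec.fst))
  exact (primrecPred_eval_ne_none hR T p1 (primrec_entropyQuery.comp n)).and
    ((primrecPred_eval_ne_none hR T (Primrec.fst.comp q1) n).and
      (hrel.forall_mem_list.comp L w))

theorem primrecPred_certificateBounds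
    (hR : Primrec fun a : ℕ × List Bool × ℕ => R a.1 a.2.1 a.2.2) :
    PrimrecPred (CertificateBounds R) := by
  have w : Primrec (id : LevelSetCertificate → LevelSetCertificate) := Primrec.id
  have w2 := Primrec.snd.comp w
  have T := Primrec.fst.comp w2
  have n := Primrec.fst.comp (Primrec.snd.comp w2)
  have c := Primrec.fst.comp (Primrec.snd.comp (Primrec.snd.comp w2))
  have L := Primrec.snd.comp (Primrec.snd.comp (Primrec.snd.comp w2))
  have p1 := Primrec.fst.comp (Primrec.fst.comp w)
  have q1 := Primrec.snd.comp (Primrec.fst.comp w)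
  have h := primrec_evalFloor hR T n p1 (primrec_entropyQuery.comp n)
  have d := primrec_evalFloor hR T n (Primrec.fst.comp q1) n
  have e := primrec_evalFloor hR T n (Primrec.fst.comp (Primrec.snd.comp q1)) n
  have sum := primrec_list_sum.comp (Primrec.list_map L (primrec_certificateProb hR))
  exact (primrecPred_thresholdLower h d e n c).and ((primrecPred_thresholdUpper h d n c).and
    ((primrecPred_nodup.comp L).and (Primrec.nat_lt.comp
      (primrec_nat_pow.comp (Primrec.const 2) n)
      (Primrec.nat_add.comp (Primrec.nat_add.comp sum c) (Primrec.const 3)))))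

theorem primrecRel_isCertificate
    (hR : Primrec fun a : ℕ × List Bool × ℕ => R a.1 a.2.1 a.2.2) :
    PrimrecRel (IsCertificate R) := by
  have w : Primrec (Prod.snd : List Bool × LevelSetCertificate → _) := Primrec.snd
  have p1 := Primrec.fst.comp (Primrec.fst.comp w)
  have q1 := Primrec.snd.comp (Primrec.fst.comp w)
  have q2 := Primrec.snd.comp q1
  exact (Primrec.eq.comp Primrec.fst (Primrec.list_append.comp p1
      (Primrec.list_append.comp (Primrec.fst.comp q1)
        (Primrec.list_append.comp (Primrec.fst.comp q2) (Primrec.snd.comp q2))))).and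
    (((primrecPred_certificateParses hR).comp w).and
      (((primrecPred_certificateHalts hR).comp w).and ((primrecPred_certificateBounds hR).comp w)))

theorem primrec_certificateOutput
    (hR : Primrec fun a : ℕ × List Bool × ℕ => R a.1 a.2.1 a.2.2) :
    Primrec (certificateOutput R) := by
  have w : Primrec (id : LevelSetCertificate → LevelSetCertificate) := Primrec.id
  have w2 := Primrec.snd.comp w
  have T := Primrec.fst.comp w2
  have c := Primrec.fst.comp (Primrec.snd.comp (Primrec.snd.comp w2))
  have L := Primrec.snd.comp (Primrec.snd.comp (Primrec.snd.comp w2))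
  have p4 := Primrec.snd.comp (Primrec.snd.comp (Primrec.snd.comp (Primrec.fst.comp w)))
  have v : Primrec (Prod.snd : List Bool × LevelSetCertificate → _) := Primrec.snd
  have hrel : PrimrecRel fun (s : List Bool) (w : LevelSetCertificate) =>
      w.2.2.2.1 ≤ certificateProb R w s ∧
        R w.2.1 w.1.2.2.2 (Encodable.encode s) = some (Encodable.encode true) :=
    (Primrec.nat_le.comp (c.comp v) ((primrec_certificateProb hR).comp v Primrec.fst)).and
      (Primrec.eq.comp (primrec_eval hR (T.comp v) (p4.comp v) (Primrec.encode.comp Primrec.fst))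
        (Primrec.const _))
  exact hrel.listFilter.comp L w

end Primrec

/-! ### The machine that outputs certified level sets -/

theorem IsPrefixComputer.append_inj {U : List Bool → ℕ →. ℕ} (hU : IsPrefixComputer U) {y : ℕ}
    {p q a b : List Bool} (hp : (U p y).Dom) (hq : (U q y).Dom) (h : p ++ a = q ++ b) :
    p = q ∧ a = b := by
  rcases List.append_eq_append_iff.1 h with ⟨t, rfl, rfl⟩ | ⟨t, rfl, rfl⟩
  · simp [hU.2 y p t hp hq]
  · simp [hU.2 y q t hq hp]

/-- The domain of `U` is prefix-free only for a fixed input, and the two certificates may use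
different accuracies. Each of the four programs is therefore also required to halt on an input
independent of the certificate, and they are split off one at a time. -/
theorem IsCertificate.append_unique {U : List Bool → ℕ →. ℕ} (hU : IsPrefixComputer U)
    {R : ℕ → List Bool → ℕ → Option ℕ} (hR : ∀ T p y v, R T p y = some v → v ∈ U p y)
    {p t : List Bool} {w w' : LevelSetCertificate} (h : IsCertificate R p w)
    (h' : IsCertificate R (p ++ t) w') : w.1 = w'.1 ∧ t = [] := by
  have dom : ∀ {T p y}, R T p y ≠ none → (U p y).Dom := fun {T p y} hne => by
    obtain ⟨v, hv⟩ := Option.ne_none_iff_exists'.1 hne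
    exact Part.dom_iff_mem.2 ⟨v, hR _ _ _ _ hv⟩
  obtain ⟨⟨p1, p2, p3, p4⟩, T, n, c, L⟩ := w
  obtain ⟨⟨q1, q2, q3, q4⟩, T', n', c', L'⟩ := w'
  obtain ⟨rfl, ⟨a1, a2, a3, a4⟩, -⟩ := h
  obtain ⟨e, ⟨b1, b2, b3, b4⟩, -⟩ := h'
  dsimp only at a1 a2 a3 a4 b1 b2 b3 b4 e
  simp only [List.append_assoc] at e
  obtain ⟨rfl, e₁⟩ := hU.append_inj (dom a1) (dom b1) e
  obtain ⟨rfl, e₂⟩ := hU.append_inj (dom a2) (dom b2) e₁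
  obtain ⟨rfl, e₃⟩ := hU.append_inj (dom a3) (dom b3) e₂
  have e' : p4 ++ t = q4 ++ [] := by simpa using e₃
  obtain ⟨rfl, e₄⟩ := hU.append_inj (dom a4) (dom b4) e'
  exact ⟨rfl, e₄⟩

/-- The machine ignores its input and searches for a certificate for `p`. Nothing is known about
which one it finds, hence the possibly different `w'`. -/
theorem exists_levelSetComputer {U : List Bool → ℕ →. ℕ} (hU : IsPrefixComputer U)
    {R : ℕ → List Bool → ℕ → Option ℕ}
    (hprim : Primrec fun a : ℕ × List Bool × ℕ => R a.1 a.2.1 a.2.2)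
    (hR : ∀ T p y v, R T p y = some v → v ∈ U p y) :
    ∃ M : List Bool → ℕ →. ℕ, IsPrefixComputer M ∧
      ∀ p w, IsCertificate R p w → ∀ y, ∃ w', IsCertificate R p w' ∧
        Encodable.encode (certificateOutput R w') ∈ M p y := by
  classical
  obtain ⟨f, hf, hsound, hdom⟩ := exists_partrec_search
    (g := fun p w => if IsCertificate R p w then some (certificateOutput R w) else none)
    (Primrec.ite (primrecRel_isCertificate hprim)
      (Primrec.option_some.comp ((primrec_certificateOutput hprim).comp Primrec.snd))
      (Primrec.const none))
  have hmem : ∀ p, ∀ l ∈ f p, ∃ w, IsCertificate R p w ∧ certificateOutput R w = l := by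
    intro p l hl
    obtain ⟨w, hw⟩ := hsound p l hl
    split_ifs at hw with h
    exact ⟨w, h, Option.some.inj hw⟩
  refine ⟨fun p _ => (f p).map Encodable.encode, ⟨?_, ?_⟩, ?_⟩
  · exact (hf.comp Computable.fst).map (Computable.encode.comp Computable.snd).to₂
  · intro y p t h h'
    obtain ⟨w, hw, -⟩ := hmem p _ (Part.get_mem (o := f p) h)
    obtain ⟨w', hw', -⟩ := hmem (p ++ t) _ (Part.get_mem (o := f (p ++ t)) h')
    exact (hw.append_unique hU hR hw').2
  · intro p w hw y
    have hd := hdom p ⟨w, by simp [hw]⟩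
    obtain ⟨w', hw', he⟩ := hmem p _ (Part.get_mem hd)
    exact ⟨w', hw', he ▸ Part.mem_map _ (Part.get_mem hd)⟩

/-! ### Level sets of ensembles -/

theorem PMF.hasSum_toReal {α : Type*} (E : PMF α) : HasSum (fun s => (E s).toReal) 1 := by
  have := ENNReal.hasSum_toReal (f := fun s => E s) (by simp [E.tsum_coe])
  simpa [E.tsum_coe, ← ENNReal.tsum_toReal_eq E.apply_ne_top] using this

/-- The programs `p₁`, `p₂`, `p₃`, `p₄` compute `E` and its entropy, `δ`, `ε` and `C`. -/
structure AreProgramsFor (U : List Bool → ℕ →. ℕ) (E : PMF (List Bool)) (δ ε : ℝ)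
    (C : Set (PMF (List Bool))) (p₁ p₂ p₃ p₄ : List Bool) : Prop where
  prob : ∀ s n, ∃ m ∈ U p₁ (probQuery s n), IsApprox m n (E s).toReal
  entropy : ∀ n, ∃ m ∈ U p₁ (entropyQuery n), IsApprox m n (entropy E).toReal
  delta : ∀ n, ∃ m ∈ U p₂ n, IsApprox m n δ
  epsilon : ∀ n, ∃ m ∈ U p₃ n, IsApprox m n ε
  constraint_mem : ∀ s, PMF.pure s ∈ C → Encodable.encode true ∈ U p₄ (Encodable.encode s)
  constraint_not_mem : ∀ s, PMF.pure s ∉ C → Encodable.encode false ∈ U p₄ (Encodable.encode s)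

section

variable {U : List Bool → ℕ →. ℕ} {R : ℕ → List Bool → ℕ → Option ℕ}

theorem isScaledApprox_evalFloor (hR : ∀ T p y v, R T p y = some v → v ∈ U p y) {T n y : ℕ}
    {p : List Bool} {r : ℝ} (hr : 0 ≤ r) (h : ∃ m ∈ U p y, IsApprox m n r) (hne : R T p y ≠ none) :
    IsScaledApprox (evalFloor R T n p y) n r := by
  obtain ⟨v, hv⟩ := Option.ne_none_iff_exists'.1 hne
  obtain ⟨m, hm, ha⟩ := h
  obtain rfl := Part.mem_unique hm (hR _ _ _ _ hv)
  simpa [evalFloor, hv] using ha.isScaledApprox hr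

theorem evalFloor_le (hR : ∀ T p y v, R T p y = some v → v ∈ U p y) {T n y : ℕ}
    {p : List Bool} {r : ℝ} (hr : 0 ≤ r) (h : ∃ m ∈ U p y, IsApprox m n r) :
    (evalFloor R T n p y : ℝ) ≤ 2 ^ n * r := by
  by_cases hne : R T p y = none
  · simp only [evalFloor, hne, Option.map_none, Option.getD_none, Nat.cast_zero]
    positivity
  · exact (isScaledApprox_evalFloor hR hr h hne).1

variable {E : PMF (List Bool)} {δ ε : ℝ} {C : Set (PMF (List Bool))} {p₁ p₂ p₃ p₄ : List Bool}

theorem AreProgramsFor.exists_isCertificate (hp : AreProgramsFor U E δ ε C p₁ p₂ p₃ p₄)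
    (hR : ∀ p y v, v ∈ U p y → ∀ᶠ T in atTop, R T p y = some v) (hδ : 0 ≤ δ) (hε : 0 < ε) :
    ∃ w, IsCertificate R (p₁ ++ (p₂ ++ (p₃ ++ p₄))) w ∧ w.1 = (p₁, p₂, p₃, p₄) := by
  choose a ha ha' using hp.prob
  choose h hh hh' using hp.entropy
  choose d hd hd' using hp.delta
  choose e he he' using hp.epsilon
  have hC : ∀ s, ∃ b, b ∈ U p₄ (Encodable.encode s) := fun s => by
    by_cases hs : PMF.pure s ∈ C
    · exact ⟨_, hp.constraint_mem s hs⟩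
    · exact ⟨_, hp.constraint_not_mem s hs⟩
  choose b hb using hC
  obtain ⟨n, c, L, h1, h2, h3⟩ := exists_thresholds (PMF.hasSum_toReal E)
    (fun n => (hh' n).isScaledApprox ENNReal.toReal_nonneg) (fun n => (hd' n).isScaledApprox hδ)
    (fun n => (he' n).isScaledApprox hε.le)
    (fun s n => (ha' s n).isScaledApprox ENNReal.toReal_nonneg) hε
  have hL : ∀ᶠ T in atTop, ∀ s ∈ L, R T p₁ (probQuery s n) = some (a s n) ∧
      R T p₄ (Encodable.encode s) = some (b s) :=
    (eventually_all_finset L).2 fun s _ => (hR _ _ _ (ha s n)).and (hR _ _ _ (hb s))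
  -- Only finitely many evaluations matter, so one step bound serves for all of them.
  obtain ⟨T, hL, t1, t2, t3, t4, t5, t6, t7⟩ := (hL.and <| (hR _ _ _ (hh 0)).and <|
    (hR _ _ _ (hd 0)).and <| (hR _ _ _ (he 0)).and <| (hR _ _ _ (hb [])).and <|
    (hR _ _ _ (hh n)).and <| (hR _ _ _ (hd n)).and (hR _ _ _ (he n))).exists
  refine ⟨((p₁, p₂, p₃, p₄), T, n, c, L.toList), ⟨rfl, ?_, ?_, ?_⟩, rfl⟩
  · exact ⟨t1.trans_ne (Option.some_ne_none _), t2.trans_ne (Option.some_ne_none _),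
      t3.trans_ne (Option.some_ne_none _), t4.trans_ne (Option.some_ne_none _)⟩
  · refine ⟨by simp [t5], by simp [t6], fun s hs => ?_⟩
    obtain ⟨k1, k2⟩ := hL s (Finset.mem_toList.1 hs)
    simp [k1, k2]
  · refine ⟨by simpa [evalFloor, t5, t6, t7] using h1, by simpa [evalFloor, t5, t6] using h2,
      L.nodup_toList, ?_⟩
    have hsum : (L.toList.map (certificateProb R ((p₁, p₂, p₃, p₄), T, n, c, L.toList))).sum
        = ∑ s ∈ L, dyadicFloor n (a s n) := by
      rw [Finset.sum_map_toList]
      refine Finset.sum_congr rfl fun s hs => ?_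
      simp [certificateProb, evalFloor, (hL s hs).1]
    simpa only [hsum] using h3

theorem AreProgramsFor.certificateOutput_spec (hp : AreProgramsFor U E δ ε C p₁ p₂ p₃ p₄)
    (hR : ∀ T p y v, R T p y = some v → v ∈ U p y) (hδ : 0 ≤ δ) (hε : 0 < ε)
    {x : List Bool} (hx : IsTypical δ x E) (hxC : PMF.pure x ∈ C) {p : List Bool}
    {w : LevelSetCertificate} (hw : IsCertificate R p w) (hw1 : w.1 = (p₁, p₂, p₃, p₄)) :
    x ∈ certificateOutput R w ∧ (∀ s ∈ certificateOutput R w, PMF.pure s ∈ C) ∧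
      Real.logb 2 ((certificateOutput R w).toFinset.card : ℝ)
        ≤ (_root_.entropy E).toReal * (1 + δ) + ε := by
  obtain ⟨P, T, n, c, L⟩ := w
  obtain rfl : P = (p₁, p₂, p₃, p₄) := hw1
  set w : LevelSetCertificate := ((p₁, p₂, p₃, p₄), T, n, c, L)
  obtain ⟨-, -, ⟨i1, i2, i3⟩, j1, j2, j3, j4⟩ := hw
  have hH : 0 ≤ (_root_.entropy E).toReal := ENNReal.toReal_nonneg
  have hh := isScaledApprox_evalFloor hR hH (hp.entropy n) i1
  have hd := isScaledApprox_evalFloor hR hδ (hp.delta n) i2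
  -- No halting is needed here: a timed-out evaluation counts as 0, still a lower bound.
  have he := evalFloor_le hR (T := T) hε.le (hp.epsilon n)
  have hs := fun s => evalFloor_le hR (T := T) ENNReal.toReal_nonneg (hp.prob s n)
  have hsum1 : ∀ S : Finset (List Bool), ∑ s ∈ S, (E s).toReal ≤ 1 := fun S =>
    sum_le_hasSum S (fun _ _ => ENNReal.toReal_nonneg) (PMF.hasSum_toReal E)
  have hcx : (c : ℝ) + 3 ≤ 2 ^ n * (E x).toReal := ThresholdUpper.le j2 hh hd hδ hx
  -- Otherwise `x`, with scaled probability at least `c + 3`, would push the mass of `L ∪ {x}` above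
  -- 1.
  have hxL : x ∈ L := by
    by_contra hxL
    have hxL' : x ∉ L.toFinset := by simpa using hxL
    have k := hsum1 (insert x L.toFinset)
    rw [Finset.sum_insert hxL'] at k
    have k1 : ((L.map (certificateProb R w)).sum : ℝ) ≤ 2 ^ n * ∑ s ∈ L.toFinset, (E s).toReal := by
      rw [← List.sum_toFinset _ j3, Nat.cast_sum, Finset.mul_sum]
      exact Finset.sum_le_sum fun s _ => hs s
    have k2 : (2 : ℝ) ^ n < ((L.map (certificateProb R w)).sum : ℝ) + c + 3 := by exact_mod_cast j4
    have k3 : (0 : ℝ) < 2 ^ n := by positivity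
    nlinarith
  have hxout : x ∈ certificateOutput R w := by
    obtain ⟨l1, l2⟩ := i3 x hxL
    refine List.mem_filter.2 ⟨hxL, decide_eq_true ⟨?_, ?_⟩⟩
    · have := (isScaledApprox_evalFloor hR ENNReal.toReal_nonneg (hp.prob x n) l1).2
      have : (c : ℝ) ≤ evalFloor R T n p₁ (probQuery x n) := by linarith
      exact_mod_cast this
    · obtain ⟨v, hv⟩ := Option.ne_none_iff_exists'.1 l2
      rw [Part.mem_unique (hp.constraint_mem x hxC) (hR _ _ _ _ hv)]
      exact hv
  refine ⟨hxout, fun s hs => ?_, ?_⟩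
  · have h1 := hR _ _ _ _ (of_decide_eq_true (List.mem_filter.1 hs).2).2
    by_contra hsC
    simpa using Part.mem_unique h1 (hp.constraint_not_mem s hsC)
  · refine ThresholdLower.logb_card_le hsum1 j1 hh hd he ⟨x, by simpa using hxout⟩ fun s hs' => ?_
    have h1 := (of_decide_eq_true (List.mem_filter.1 (List.mem_toFinset.1 hs')).2).1
    exact le_trans (by exact_mod_cast h1) (hs s)

end

/-! ### Uniform distributions in convex sets -/

theorem isComputableReal_inv_natCast (k : ℕ) (hk : 0 < k) : IsComputableReal (k : ℝ)⁻¹ := by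
  refine ⟨fun n => Nat.pair (2 ^ n / k) n, ?_, fun n => ?_⟩
  · exact (Primrec₂.natPair.comp (Primrec.nat_div.comp
      (primrec_nat_pow.comp (Primrec.const 2) Primrec.id) (Primrec.const k)) Primrec.id).to_comp
  · unfold IsApprox
    have hk' : (0 : ℝ) < k := by exact_mod_cast hk
    have h2 : (0 : ℝ) < 2 ^ n := by positivity
    have h1 : ((2 ^ n / k : ℕ) : ℝ) ≤ 2 ^ n * (k : ℝ)⁻¹ := by
      have := @Nat.cast_div_le ℝ _ _ _ (2 ^ n) k
      push_cast at this
      rwa [div_eq_mul_inv] at this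
    have h3 : (2 ^ n * (k : ℝ)⁻¹ : ℝ) ≤ (2 ^ n / k : ℕ) + 1 := by
      rw [← div_eq_mul_inv, div_le_iff₀ hk', mul_comm]
      exact_mod_cast (Nat.lt_mul_div_succ (2 ^ n) hk).le
    rw [Nat.unpair_pair, abs_le, le_sub_iff_add_le, sub_le_iff_le_add]
    constructor
    · rw [le_div_iff₀ h2, add_mul, neg_mul, one_div, inv_mul_cancel₀ h2.ne']
      linarith
    · rw [div_le_iff₀ h2, add_mul, one_div, inv_mul_cancel₀ h2.ne']
      linarith

theorem IsConvexConstraint.uniformOfFinset_mem {C : Set (PMF (List Bool))}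
    (hC : IsConvexConstraint C) {S : Finset (List Bool)} (hS : S.Nonempty)
    (h : ∀ s ∈ S, PMF.pure s ∈ C) : PMF.uniformOfFinset S hS ∈ C := by
  -- Convex weights must be less than 1, so a singleton is treated separately, as a Dirac measure.
  rcases Nat.lt_or_ge 1 S.card with h1 | h1
  · have hk : (1 : ℝ) < S.card := by exact_mod_cast h1
    refine hC S.card (fun i => PMF.pure (S.equivFin.symm i : List Bool)) (fun _ => (S.card : ℝ)⁻¹) _
      (fun i => h _ (S.equivFin.symm i).2) (fun _ => ⟨by positivity, inv_lt_one_of_one_lt₀ hk⟩)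
      (fun _ => isComputableReal_inv_natCast _ hS.card_pos) ?_ fun s => ?_
    · simp [hS.ne_empty]
    · rw [Equiv.sum_comp S.equivFin.symm
        (fun t : S => (S.card : ℝ)⁻¹ * ((PMF.pure (t : List Bool)) s).toReal),
        Finset.sum_coe_sort S (fun t => (S.card : ℝ)⁻¹ * ((PMF.pure t) s).toReal), ← Finset.mul_sum,
        PMF.uniformOfFinset_apply]
      have hpure : ∀ t, (PMF.pure t s).toReal = if s = t then (1 : ℝ) else 0 := fun t => by
        rw [PMF.pure_apply]
        split_ifs <;> simp
      simp only [hpure, Finset.sum_ite_eq]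
      split_ifs <;> simp
  · obtain ⟨a, rfl⟩ := Finset.card_eq_one.1 (le_antisymm h1 hS.card_pos)
    have : PMF.uniformOfFinset {a} hS = PMF.pure a := by
      ext s
      simp [PMF.uniformOfFinset_apply, PMF.pure_apply]
    rw [this]
    exact h a (by simp)

/-! ### Main theorem -/

theorem exists_length_eq_shortestLength {P : List Bool → Prop} (h : shortestLength P ≠ ⊤) :
    ∃ p, P p ∧ (p.length : ℕ∞) = shortestLength P := by
  unfold shortestLength at h ⊢
  rw [iInf_subtype'] at h ⊢
  have : Nonempty {p // P p} := by
    by_contra hne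
    rw [not_nonempty_iff] at hne
    exact h (iInf_of_empty _)
  obtain ⟨⟨p, hp⟩, he⟩ := ciInf_mem fun p : {p // P p} => ((p : List Bool).length : ℕ∞)
  exact ⟨p, hp, he⟩

theorem exists_areProgramsFor {U : List Bool → ℕ →. ℕ} {E : PMF (List Bool)} {δ ε : ℝ}
    {C : Set (PMF (List Bool))} (hE : KEnsemble U E ≠ ⊤) (hδ : KReal U δ ≠ ⊤) (hε : KReal U ε ≠ ⊤)
    (hC : KConstraint U C ≠ ⊤) :
    ∃ p₁ p₂ p₃ p₄, AreProgramsFor U E δ ε C p₁ p₂ p₃ p₄ ∧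
      ((p₁ ++ (p₂ ++ (p₃ ++ p₄))).length : ℕ∞)
        = KEnsemble U E + KReal U δ + KReal U ε + KConstraint U C := by
  obtain ⟨p₁, ⟨h1, h1'⟩, l1⟩ := exists_length_eq_shortestLength hE
  obtain ⟨p₂, h2, l2⟩ := exists_length_eq_shortestLength hδ
  obtain ⟨p₃, h3, l3⟩ := exists_length_eq_shortestLength hε
  obtain ⟨p₄, h4, l4⟩ := exists_length_eq_shortestLength hC
  refine ⟨p₁, p₂, p₃, p₄, ⟨h1, h1', h2, h3, fun s hs => ?_, fun s hs => ?_⟩, ?_⟩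
  · simpa [hs] using h4 s
  · simpa [hs] using h4 s
  · rw [KEnsemble, KReal, KReal, KConstraint, ← l1, ← l2, ← l3, ← l4]
    simp only [List.length_append, Nat.cast_add, add_assoc]

theorem mainTheorem9 (U : List Bool → ℕ →. ℕ) (hU : IsUniversalPrefixComputer U) :
    ∃ c : ℕ, ∀ (x : List Bool) (δ Δ : ℝ), 0 ≤ δ → 0 ≤ Δ →
      ∀ C : Set (PMF (List Bool)), C ⊆ ensembles →
        IsConvexConstraint C → IsDecidableConstraint C → PMF.pure x ∈ C →
      ∀ D : Set (PMF (List Bool)), D ⊆ ensembles → effectiveComplexity U δ Δ x D ≠ ⊤ →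
      ∀ E : PMF (List Bool), IsMinimizingEnsemble U δ Δ x D E →
      ∀ ε : ℝ, 0 < ε →
        ∃ (S : Finset (List Bool)) (hx : x ∈ S),
          Real.logb 2 (S.card : ℝ) ≤ (entropy E).toReal * (1 + δ) + ε ∧
          KFinset U S ≤ KEnsemble U E + c + KReal U δ + KReal U ε + KConstraint U C ∧
          PMF.uniformOfFinset S ⟨x, hx⟩ ∈ C := by
  obtain ⟨R, hprim, hsound, hcomplete⟩ := exists_stepBounded hU.1.1
  obtain ⟨M, hM, hout⟩ := exists_levelSetComputer hU.1 hprim hsound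
  obtain ⟨c, hc⟩ := hU.2 M hM
  refine ⟨c, fun x δ Δ hδ _ C _ hconv _ hxC D _ _ E hmin ε hε => ?_⟩
  have hx : IsTypical δ x E := hmin.1.1.2.1
  -- If some complexity is infinite, for instance for an uncomputable `δ` or `ε`, the bound on
  -- `KFinset` is vacuous and `{x}` will do.
  by_cases htop : KEnsemble U E ≠ ⊤ ∧ KReal U δ ≠ ⊤ ∧ KReal U ε ≠ ⊤ ∧ KConstraint U C ≠ ⊤
  · obtain ⟨p₁, p₂, p₃, p₄, hp, hlen⟩ :=
      exists_areProgramsFor htop.1 htop.2.1 htop.2.2.1 htop.2.2.2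
    obtain ⟨w, hw, hw0⟩ := hp.exists_isCertificate hcomplete hδ hε
    obtain ⟨w', hw', hw'M⟩ := hout _ _ hw 0
    -- The certificate found may differ from `w` in its numbers and list, but unique parsing forces
    -- the same four programs.
    have hw1 : w'.1 = (p₁, p₂, p₃, p₄) := by
      rw [← List.append_nil (p₁ ++ _)] at hw'
      rw [← hw0, (hw.append_unique hU.1 hsound hw').1]
    obtain ⟨h1, h2, h3⟩ := hp.certificateOutput_spec hsound hδ hε hx hxC hw' hw1
    obtain ⟨q, hq, hqM⟩ := hc (p₁ ++ (p₂ ++ (p₃ ++ p₄)))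
    refine ⟨(certificateOutput R w').toFinset, by simpa using h1, h3, ?_,
      hconv.uniformOfFinset_mem _ fun s hs => h2 s (by simpa using hs)⟩
    calc KFinset U (certificateOutput R w').toFinset ≤ q.length :=
          iInf₂_le q ⟨_, rfl, by rw [hqM]; exact hw'M⟩
      _ ≤ ((p₁ ++ (p₂ ++ (p₃ ++ p₄))).length : ℕ∞) + c := by exact_mod_cast hq
      _ = KEnsemble U E + c + KReal U δ + KReal U ε + KConstraint U C := by rw [hlen]; ring
  · refine ⟨{x}, by simp, ?_, ?_, hconv.uniformOfFinset_mem _ fun s hs => ?_⟩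
    · have : 0 ≤ (entropy E).toReal := ENNReal.toReal_nonneg
      simp only [Finset.card_singleton, Nat.cast_one, Real.logb_one]
      positivity
    · simp only [ne_eq, ← not_or, not_not] at htop
      rcases htop with h | h | h | h <;> simp [h]
    · rwa [Finset.mem_singleton.1 hs]
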